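/- Let $r\ge 0$, let $m_1,\dots,m_r$ be positive integers, $m=m_1+\dots+m_r$, $\mathbf f=(f_1,\dots,f_r)\in\mathbb C^r$ and $b,c\in\mathbb C$. Write $(a)_n=a(a+1)\cdots(a+n-1)$. Let $\alpha_0,\dots,\alpha_m$ be the coefficients defined by $$\prod_{i=1}^r (f_i-b-x)_{m_i}=\sum_{j=0}^m\alpha_jx^j ,$$ let $S(j,k)$ be the Stirling numbers of the second kind, and put $D_k=\sum_{j=k}^m\alpha_jS(j,k)$ for $0\le k\le m$. For $t\in\mathbb C$ with $0<|t|<1$ let $G(t)=G^{r+1,0}_{r+1,r+1}\left(t\,\middle|\,{c,\,f_1,\dots,f_r\atop b,\,f_1+m_1,\dots,f_r+m_r}\right)$ be the Meijer–Nørlund function, that is, $$G(t)=\frac1{2\pi i}\int_{\mathcal L}\frac{\Gamma(b-s)\prod_{i=1}^r\Gamma(f_i+m_i-s)}{\Gamma(c-s)\prod_{i=1}^r\Gamma(f_i-s)}\,t^s\,ds ,$$ where $t^s$ is the principal power and, for real $X,Y$ with $Y>0$ such that $X<\operatorname{Re}\beta$ and $|\operatorname{Im}\beta|<Y$ for each $\beta\in\{b,f_1+m_1,\dots,f_r+m_r\}$,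 the loop $\mathcal L$ consists of the straight pieces from $+\infty-iY$ to $X-iY$, from there to $X+iY$, and from there to $+\infty+iY$ (so that $\mathcal L$ goes once, in the negative sense, around all poles of the numerator). This integral converges absolutely and does not depend on the choice of $X,Y$. Moreover, for all $t\in\mathbb C$ with $0<|t|<1$, $$G(t)=\frac{t^b(1-t)^{c-b-1}}{\Gamma(c-b)}\sum_{k=0}^m D_k\,(c-b-k)_k\,\frac{t^k}{(t-1)^k},$$ with principal powers and with $1/\Gamma(c-b)=0$ if $c-b\in\{0,-1,-2,\dots\}$. Finally, for every $0\le k\le m$ such that $(1-f_i+b-m_i)_k\neq0$ for $i=1,\dots,r$, $$D_k=\frac{(-1)^k\prod_{i=1}^r(f_i-b)_{m_i}}{k!}\;{}_{r+1}F_r\!\left({-k,\;1-f_1+b,\dots,1-f_r+b\atop 1-f_1+b-m_1,\dots,1-f_r+b-m_r};1\right).$$ -/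

import Mathlib

open scoped BigOperators

noncomputable section

/-- The rising factorial `(a)_n = a (a + 1) ⋯ (a + n - 1)`. -/
def risingFac (a : ℂ) (n : ℕ) : ℂ := (ascPochhammer ℂ n).eval a

/-- The generalized hypergeometric series `pFq(a; b; x) = ∑ₙ (a)ₙ / (b)ₙ * xⁿ / n!`. -/
def hypergeometricPFQ {p q : ℕ} (a : Fin p → ℂ) (b : Fin q → ℂ) (x : ℂ) : ℂ :=
  ∑' n : ℕ, (∏ i, risingFac (a i) n) / (∏ i, risingFac (b i) n) * x ^ n / (n.factorial : ℂ)

/-- The Mellin–Barnes integrand of Meijer's function `G^{p,0}_{p,p}(z | a; b)`: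
`Γ(b₁ - s) ⋯ Γ(b_p - s) / (Γ(a₁ - s) ⋯ Γ(a_p - s)) * z ^ s`, with the principal power.
(At a pole of `Γ(a_j - s)` the value `Complex.Gamma = 0` gives the correct value `0` of
`1 / Γ(a_j - s)`.) -/
def meijerIntegrand {p : ℕ} (a b : Fin p → ℂ) (z s : ℂ) : ℂ :=
  (∏ j, Complex.Gamma (b j - s)) * (∏ j, (Complex.Gamma (a j - s))⁻¹) * z ^ s

/-- The loop with corners `X ± iY` that comes from `+∞ - iY`, runs to `X - iY`, then to `X + iY`
and returns to `+∞ + iY`, goes around all the poles `b_j + l` (`l = 0, 1, 2, …`) of the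
functions `Γ(b_j - s)`. -/
def IsMeijerLoop {p : ℕ} (b : Fin p → ℂ) (X Y : ℝ) : Prop :=
  0 < Y ∧ ∀ j, X < (b j).re ∧ |(b j).im| < Y

/-- Absolute convergence of the integral of `F` over the loop with corners `X ± iY`. -/
def LoopIntegrable (F : ℂ → ℂ) (X Y : ℝ) : Prop :=
  MeasureTheory.IntegrableOn (fun x : ℝ => F (x - Y * Complex.I)) (Set.Ioi X) ∧
  IntervalIntegrable (fun y : ℝ => F (X + y * Complex.I)) MeasureTheory.volume (-Y) Y ∧
  MeasureTheory.IntegrableOn (fun x : ℝ => F (x + Y * Complex.I)) (Set.Ioi X)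

/-- The integral of `F` over the loop from `+∞ - iY` via `X - iY` and `X + iY` to `+∞ + iY`,
that is, in the negative (clockwise) sense around the half-strip. -/
def loopIntegral (F : ℂ → ℂ) (X Y : ℝ) : ℂ :=
  -(∫ x in Set.Ioi X, F (x - Y * Complex.I))
    + Complex.I * (∫ y in (-Y)..Y, F (X + y * Complex.I))
    + ∫ x in Set.Ioi X, F (x + Y * Complex.I)

/-- The Mellin–Barnes integral `(2πi)⁻¹ ∫ …` over the loop with corners `X ± iY`. -/
def meijerLoopValue {p : ℕ} (a b : Fin p → ℂ) (z : ℂ) (X Y : ℝ) : ℂ :=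
  (2 * Real.pi * Complex.I)⁻¹ * loopIntegral (meijerIntegrand a b z) X Y

/-- The Meijer–Nørlund function `G^{p,0}_{p,p}(z | a; b)` for `0 < |z| < 1`: the Mellin–Barnes
integral over a loop around all the poles of the numerator. One such loop is fixed here, with
`Y = -X = 1 + ∑ⱼ |b_j|`. -/
def meijerNorlundG {p : ℕ} (a b : Fin p → ℂ) (z : ℂ) : ℂ :=
  meijerLoopValue a b z (-(1 + ∑ j, ‖b j‖)) (1 + ∑ j, ‖b j‖)

/-- The fixed loop does go around all the poles. -/
theorem isMeijerLoop_default {p : ℕ} (b : Fin p → ℂ) :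
    IsMeijerLoop b (-(1 + ∑ j, ‖b j‖)) (1 + ∑ j, ‖b j‖) := by
  have h0 : 0 ≤ ∑ j, ‖b j‖ := Finset.sum_nonneg fun j _ => norm_nonneg _
  refine ⟨by linarith, fun j => ?_⟩
  have h1 : ‖b j‖ ≤ ∑ j, ‖b j‖ :=
    Finset.single_le_sum (f := fun j => ‖b j‖) (fun j _ => norm_nonneg _) (Finset.mem_univ j)
  have h2 := abs_le.1 (Complex.abs_re_le_norm (b j))
  have h3 := Complex.abs_im_le_norm (b j)
  exact ⟨by linarith [h2.1], by linarith⟩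

/-- The number `α_j`: the coefficient of `t ^ j` in the polynomial
`(f - b - t)_m = ∏ᵢ (f_i - b - t)_{m_i}`. -/
def alphaCoeff {r : ℕ} (f : Fin r → ℂ) (m : Fin r → ℕ) (b : ℂ) (j : ℕ) : ℂ :=
  (∏ i, (ascPochhammer ℂ (m i)).comp
    (Polynomial.C (f i - b) - (Polynomial.X : Polynomial ℂ))).coeff j

/-- `D_k = ∑_{j=k}^{m} α_j S(j, k)`, `m = m_1 + ⋯ + m_r`, with Stirling numbers of the
second kind. -/
def DCoeff {r : ℕ} (f : Fin r → ℂ) (m : Fin r → ℕ) (b : ℂ) (k : ℕ) : ℂ :=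
  ∑ j ∈ Finset.Icc k (∑ i, m i), alphaCoeff f m b j * (Nat.stirlingSecond j k : ℂ)

end

/-! ### Rising factorials -/

/-! The quotient `Γ(fᵢ + mᵢ - s) / Γ(fᵢ - s)` is the polynomial `(fᵢ - s)_{mᵢ}`. On any admissible
loop the integrand therefore equals `reducedIntegrand`, whose only possible poles are `s = b + n`.
The residue there is minus `t^b / Γ(c - b)` times `∏ᵢ (fᵢ - b - n)_{mᵢ} (1 - c + b)_n t^n / n!`
(`reducedNumerator_self`), and the clockwise loop restores the sign. Shifting `s` by `1` multiplies
the integrand by a factor tending to `t` as `Re s → ∞`. This geometric decay gives absolute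
convergence and lets the loop be closed by vertical segments moving to the right, so the loop
integral is the sum of the residue series (`loopIntegral_reducedIntegrand`). To sum that series, the
polynomial in `n` is expanded in falling factorials. Since `n^j = ∑ S(j,k) n(n-1)⋯(n-k+1)`, the
coefficients are the `D_k`, and each falling factorial contributes a shifted binomial series. The
result does not involve the loop, whence the independence of `X` and `Y`. Finally, `k! D_k` is the
`k`-th forward difference at `0` of the same polynomial. Written out, this difference is the
terminating hypergeometric series. -/

theorem risingFac_zero (a : ℂ) : risingFac a 0 = 1 := by simp [risingFac]

theorem risingFac_succ (a : ℂ) (n : ℕ) : risingFac a (n + 1) = risingFac a n * (a + n) := by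
  simp [risingFac, ascPochhammer_succ_eval]

theorem risingFac_add (a : ℂ) (n k : ℕ) :
    risingFac a (n + k) = risingFac a n * risingFac (a + n) k := by
  simp [risingFac, ← ascPochhammer_mul]

theorem risingFac_succ' (a : ℂ) (n : ℕ) : risingFac a (n + 1) = a * risingFac (a + 1) n := by
  rw [add_comm, risingFac_add, risingFac_succ, risingFac_zero]
  simp

theorem risingFac_sub_natCast (a : ℂ) (n : ℕ) :
    risingFac (a - n) n = (-1) ^ n * risingFac (1 - a) n := by
  induction n with
  | zero => simp [risingFac_zero]
  | succ n ih =>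
    rw [risingFac_succ', risingFac_succ, pow_succ]
    have : a - ((n + 1 : ℕ) : ℂ) + 1 = a - n := by push_cast; ring
    rw [this, ih]
    push_cast
    ring

theorem risingFac_neg_natCast (n k : ℕ) :
    risingFac (-(n : ℂ)) k = (-1) ^ k * (n.descFactorial k : ℂ) := by
  rw [risingFac, ascPochhammer_eval_neg_eq_descPochhammer, descPochhammer_eval_eq_descFactorial]

/-- Up to `(-1)^n`, the two sides are the two ways to split `(a - n)_{n+k}`. Applied to `a = fᵢ -
b`, it produces the hypergeometric parameters of `D_k`. -/
theorem risingFac_sub_natCast_mul (a : ℂ) (k n : ℕ) :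
    risingFac (a - n) k * risingFac (1 - a - k) n = risingFac a k * risingFac (1 - a) n := by
  have h1 : risingFac (a - n) (k + n) = (-1) ^ n * (risingFac (a - n) k *
      risingFac (1 - a - k) n) := by
    rw [risingFac_add, show a - n + k = (a + k) - n by ring, risingFac_sub_natCast,
      show 1 - (a + k) = 1 - a - k by ring]
    ring
  have h2 : risingFac (a - n) (n + k) = (-1) ^ n * (risingFac a k * risingFac (1 - a) n) := by
    rw [risingFac_add, risingFac_sub_natCast, sub_add_cancel]
    ring
  rw [add_comm k n, h2] at h1
  exact (mul_left_cancel₀ (pow_ne_zero n (by norm_num)) h1).symm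

theorem risingFac_ne_zero_of_le {a : ℂ} {n k : ℕ} (hnk : n ≤ k) (h : risingFac a k ≠ 0) :
    risingFac a n ≠ 0 := by
  obtain ⟨l, rfl⟩ := Nat.exists_eq_add_of_le hnk
  rw [risingFac_add] at h
  exact left_ne_zero_of_mul h

theorem differentiable_risingFac (n : ℕ) : Differentiable ℂ fun a => risingFac a n :=
  (ascPochhammer ℂ n).differentiable

theorem hasSum_risingFac_binomial (a : ℂ) {t : ℂ} (ht : ‖t‖ < 1) :
    HasSum (fun n : ℕ => risingFac a n * t ^ n / (n.factorial : ℂ)) ((1 - t) ^ (-a)) := by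
  have h := (Complex.one_div_one_sub_cpow_hasFPowerSeriesOnBall_zero a).hasSum
    (y := t) (by simpa [Metric.mem_eball, edist_zero_right, enorm_eq_nnnorm, ← NNReal.coe_lt_one] using ht)
  rw [zero_add, one_div, ← Complex.cpow_neg] at h
  refine h.congr_fun fun n => ?_
  have h2 := Ring.factorial_nsmul_multichoose_eq_ascPochhammer a n
  rw [Polynomial.ascPochhammer_smeval_eq_eval, Ring.multichoose_eq, nsmul_eq_mul] at h2
  rw [risingFac, ← h2]
  have : (n.factorial : ℂ) ≠ 0 := by exact_mod_cast n.factorial_ne_zero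
  simp
  field_simp

/-- The terms with `n < k` vanish. After the shift `n ↦ n + k`, the factor `(a)_k t^k` comes out and
the binomial series with parameter `a + k` remains. -/
theorem hasSum_descFactorial_risingFac (a : ℂ) (k : ℕ) {t : ℂ} (ht : ‖t‖ < 1) :
    HasSum (fun n : ℕ => (n.descFactorial k : ℂ) * risingFac a n * t ^ n / (n.factorial : ℂ))
      (risingFac a k * t ^ k * (1 - t) ^ (-(a + k))) := by
  have h := (hasSum_risingFac_binomial (a + k) ht).mul_left (risingFac a k * t ^ k)
  rw [← hasSum_nat_add_iff' k]
  have h0 : ∑ i ∈ Finset.range k,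
      (i.descFactorial k : ℂ) * risingFac a i * t ^ i / (i.factorial : ℂ) = 0 := by
    refine Finset.sum_eq_zero fun i hi => ?_
    rw [Nat.descFactorial_eq_zero_iff_lt.2 (Finset.mem_range.1 hi)]
    simp
  rw [h0, sub_zero]
  refine h.congr_fun fun n => ?_
  have h1 : ((n + k).factorial : ℂ) = n.factorial * (n + k).descFactorial k := by
    have := Nat.factorial_mul_descFactorial (Nat.le_add_left k n)
    rw [Nat.add_sub_cancel] at this
    exact_mod_cast this.symm
  have h2 : ((n + k).descFactorial k : ℂ) ≠ 0 := by
    rw [Nat.cast_ne_zero, Ne, Nat.descFactorial_eq_zero_iff_lt]; omega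
  have h3 : (n.factorial : ℂ) ≠ 0 := by exact_mod_cast n.factorial_ne_zero
  rw [h1, add_comm n k, risingFac_add, pow_add]
  rw [add_comm n k] at h2
  field_simp

/-! ### Stirling numbers and the coefficients `D_k` -/

theorem pow_eq_sum_stirlingSecond_mul_descFactorial (n j : ℕ) :
    n ^ j = ∑ k ∈ Finset.range (j + 1), j.stirlingSecond k * n.descFactorial k := by
  induction j with
  | zero => simp
  | succ j ih =>
    have h (k : ℕ) : n * n.descFactorial k = n.descFactorial (k + 1) + k * n.descFactorial k := by
      rw [Nat.descFactorial_succ]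
      rcases le_or_gt k n with hk | hk
      · rw [← add_mul, Nat.sub_add_cancel hk]
      · simp [Nat.descFactorial_eq_zero_iff_lt.2 hk]
    rw [pow_succ, ih, Finset.sum_mul, Finset.sum_range_succ' _ (j + 1)]
    simp only [Nat.stirlingSecond_succ_succ, Nat.stirlingSecond_succ_zero, zero_mul, add_zero]
    have e (k : ℕ) : j.stirlingSecond k * n.descFactorial k * n =
        j.stirlingSecond k * n.descFactorial (k + 1) +
          k * j.stirlingSecond k * n.descFactorial k := by
      rw [mul_assoc, mul_comm _ n, h]; ring
    simp only [e, Finset.sum_add_distrib]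
    -- An index shift by one: the bottom term vanishes through its factor `k`, the added top term
    -- because `S(j, j+1) = 0`.
    have e' : ∑ k ∈ Finset.range (j + 1), k * j.stirlingSecond k * n.descFactorial k =
        ∑ k ∈ Finset.range (j + 1),
          (k + 1) * j.stirlingSecond (k + 1) * n.descFactorial (k + 1) := by
      rw [Finset.sum_range_succ', Finset.sum_range_succ _ j,
        Nat.stirlingSecond_eq_zero_of_lt (Nat.lt_succ_self j)]
      simp
    rw [e', add_comm, ← Finset.sum_add_distrib]
    exact Finset.sum_congr rfl fun k _ => by ring

theorem prod_risingFac_eq_sum_alphaCoeff {r : ℕ} (m : Fin r → ℕ) (f : Fin r → ℂ) (b x : ℂ) :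
    ∏ i, risingFac (f i - b - x) (m i)
        = ∑ j ∈ Finset.range ((∑ i, m i) + 1), alphaCoeff f m b j * x ^ j := by
  set p : Polynomial ℂ := ∏ i, (ascPochhammer ℂ (m i)).comp
    (Polynomial.C (f i - b) - (Polynomial.X : Polynomial ℂ)) with hp
  have hdeg : p.natDegree < (∑ i, m i) + 1 := by
    refine Nat.lt_succ_of_le ((Polynomial.natDegree_prod_le _ _).trans
      (Finset.sum_le_sum fun i _ => ?_))
    refine Polynomial.natDegree_comp_le.trans ?_
    rw [ascPochhammer_natDegree]
    have : (Polynomial.C (f i - b) - (Polynomial.X : Polynomial ℂ)).natDegree ≤ 1 :=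
      (Polynomial.natDegree_sub_le _ _).trans (by simp)
    simpa using Nat.mul_le_mul_left (m i) this
  have he : p.eval x = ∏ i, risingFac (f i - b - x) (m i) := by
    simp [hp, Polynomial.eval_prod, risingFac, Polynomial.eval_comp]
  rw [← he, Polynomial.eval_eq_sum_range' hdeg]
  rfl

theorem prod_risingFac_natCast_eq_sum_DCoeff {r : ℕ} (m : Fin r → ℕ) (f : Fin r → ℂ) (b : ℂ)
    (n : ℕ) :
    ∏ i, risingFac (f i - b - n) (m i)
        = ∑ k ∈ Finset.range ((∑ i, m i) + 1), DCoeff f m b k * (n.descFactorial k : ℂ) := by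
  rw [prod_risingFac_eq_sum_alphaCoeff]
  have h (j : ℕ) : alphaCoeff f m b j * (n : ℂ) ^ j = ∑ k ∈ Finset.range (j + 1),
      alphaCoeff f m b j * (j.stirlingSecond k : ℂ) * (n.descFactorial k : ℂ) := by
    have := congrArg (Nat.cast : ℕ → ℂ) (pow_eq_sum_stirlingSecond_mul_descFactorial n j)
    push_cast at this
    rw [this, Finset.mul_sum]
    simp only [mul_assoc]
  simp only [h, DCoeff, Finset.sum_mul]
  refine Finset.sum_comm' fun j k => ?_
  simp only [Finset.mem_range, Finset.mem_Icc]
  omega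

/-- Up to `(-1)^k`, the sum is the `k`-th forward difference at `0` of `x ↦ x.choose l`. This
orthogonality inverts expansions in falling factorials. -/
theorem sum_neg_one_pow_mul_choose_mul_choose (k l : ℕ) :
    ∑ j ∈ Finset.range (k + 1), (-1 : ℂ) ^ j * (k.choose j : ℂ) * (j.choose l : ℂ) =
      if k = l then (-1) ^ k else 0 := by
  have h := fwdDiff_iter_choose_zero l k
  rw [fwdDiff_iter_eq_sum_shift] at h
  have h2 := congrArg (fun z : ℤ => (-1 : ℂ) ^ k * (z : ℂ)) h
  simp only [Int.cast_sum, Finset.mul_sum] at h2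
  convert h2 using 1
  · refine Finset.sum_congr rfl fun j hj => ?_
    have hjk : j ≤ k := Nat.lt_succ_iff.1 (Finset.mem_range.1 hj)
    have : (-1 : ℂ) ^ k * (-1) ^ (k - j) = (-1) ^ j := by
      rw [← pow_add, show k + (k - j) = j + 2 * (k - j) by omega, pow_add, pow_mul]
      simp
    simp [← this, mul_assoc]
  · split_ifs <;> simp

theorem DCoeff_eq_sum {r : ℕ} (m : Fin r → ℕ) (f : Fin r → ℂ) (b : ℂ) {k : ℕ}
    (hk : k ≤ ∑ i, m i) :
    (k.factorial : ℂ) * DCoeff f m b k = (-1) ^ k * ∑ j ∈ Finset.range (k + 1),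
      (-1 : ℂ) ^ j * (k.choose j : ℂ) * ∏ i, risingFac (f i - b - j) (m i) := by
  have h (j : ℕ) : (-1 : ℂ) ^ j * (k.choose j : ℂ) * ∏ i, risingFac (f i - b - j) (m i) =
      ∑ l ∈ Finset.range ((∑ i, m i) + 1), DCoeff f m b l * (l.factorial : ℂ) *
        ((-1 : ℂ) ^ j * (k.choose j : ℂ) * (j.choose l : ℂ)) := by
    rw [prod_risingFac_natCast_eq_sum_DCoeff, Finset.mul_sum]
    refine Finset.sum_congr rfl fun l _ => ?_
    rw [Nat.descFactorial_eq_factorial_mul_choose]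
    push_cast
    ring
  simp only [h]
  rw [Finset.sum_comm]
  simp only [← Finset.mul_sum, sum_neg_one_pow_mul_choose_mul_choose]
  simp only [mul_ite, mul_zero, Finset.sum_ite_eq, Finset.mem_range, Nat.lt_succ_iff, hk, if_true]
  have : (-1 : ℂ) ^ k * (-1) ^ k = 1 := by rw [← mul_pow]; simp
  linear_combination -(DCoeff f m b k * k.factorial) * this

theorem DCoeff_eq_hypergeometric {r : ℕ} (m : Fin r → ℕ) (f : Fin r → ℂ) (b : ℂ) {k : ℕ}
    (hk : k ≤ ∑ i, m i) (h0 : ∀ i, risingFac (1 - f i + b - (m i : ℂ)) k ≠ 0) :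
    DCoeff f m b k
        = (-1) ^ k * (∏ i, risingFac (f i - b) (m i)) / (k.factorial : ℂ) *
          hypergeometricPFQ (Matrix.vecCons (-(k : ℂ)) (fun i => 1 - f i + b))
            (fun i => 1 - f i + b - (m i : ℂ)) 1 := by
  have hfac : (k.factorial : ℂ) ≠ 0 := by exact_mod_cast k.factorial_ne_zero
  rw [hypergeometricPFQ, tsum_eq_sum (s := Finset.range (k + 1))]
  · rw [← mul_right_inj' hfac, DCoeff_eq_sum m f b hk]
    have : (k.factorial : ℂ) * ((-1) ^ k * (∏ i, risingFac (f i - b) (m i)) / (k.factorial : ℂ)) =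
      (-1) ^ k * ∏ i, risingFac (f i - b) (m i) := by field_simp
    rw [← mul_assoc, this, mul_assoc, Finset.mul_sum (Finset.range (k + 1)) _ (∏ i, _)]
    congr 1
    refine Finset.sum_congr rfl fun n hn => ?_
    have hnk : n ≤ k := Nat.lt_succ_iff.1 (Finset.mem_range.1 hn)
    have hn0 : (n.factorial : ℂ) ≠ 0 := by exact_mod_cast n.factorial_ne_zero
    have hden : ∏ i, risingFac (1 - f i + b - (m i : ℂ)) n ≠ 0 :=
      Finset.prod_ne_zero_iff.2 fun i _ => risingFac_ne_zero_of_le hnk (h0 i)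
    have key : (∏ i, risingFac (f i - b - n) (m i)) * ∏ i, risingFac (1 - f i + b - (m i : ℂ)) n =
        (∏ i, risingFac (f i - b) (m i)) * ∏ i, risingFac (1 - f i + b) n := by
      rw [← Finset.prod_mul_distrib, ← Finset.prod_mul_distrib]
      refine Finset.prod_congr rfl fun i _ => ?_
      have := risingFac_sub_natCast_mul (f i - b) (m i) n
      rwa [show 1 - (f i - b) - (m i : ℂ) = 1 - f i + b - (m i : ℂ) by ring,
        show 1 - (f i - b) = 1 - f i + b by ring] at this
    rw [Fin.prod_univ_succ]
    simp only [Matrix.cons_val_zero, Matrix.cons_val_succ, one_pow, mul_one]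
    rw [risingFac_neg_natCast, Nat.descFactorial_eq_factorial_mul_choose]
    push_cast
    field_simp
    linear_combination (k.choose n : ℂ) * key
  · intro n hn
    rw [Finset.mem_range, not_lt] at hn
    rw [Fin.prod_univ_succ]
    simp [risingFac_neg_natCast, Nat.descFactorial_eq_zero_iff_lt.2 (Nat.lt_of_succ_le hn)]

theorem hasSum_prod_risingFac_mul_risingFac {r : ℕ} (m : Fin r → ℕ) (f : Fin r → ℂ) (b a : ℂ)
    {t : ℂ} (ht : ‖t‖ < 1) :
    HasSum (fun n : ℕ => (∏ i, risingFac (f i - b - n) (m i)) * risingFac (1 - a) n * t ^ n /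
        (n.factorial : ℂ))
      ((1 - t) ^ (a - 1) * ∑ k ∈ Finset.range ((∑ i, m i) + 1),
            DCoeff f m b k * risingFac (a - k) k * (t ^ k / (t - 1) ^ k)) := by
  have h1t : 1 - t ≠ 0 := by
    intro h
    rw [← sub_eq_zero.1 h] at ht
    simp at ht
  have h := hasSum_sum (s := Finset.range ((∑ i, m i) + 1)) fun k _ =>
    (hasSum_descFactorial_risingFac (1 - a) k ht).mul_left (DCoeff f m b k)
  have e : (1 - t) ^ (a - 1) * ∑ k ∈ Finset.range ((∑ i, m i) + 1),
      DCoeff f m b k * risingFac (a - k) k * (t ^ k / (t - 1) ^ k) =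
      ∑ k ∈ Finset.range ((∑ i, m i) + 1),
        DCoeff f m b k * (risingFac (1 - a) k * t ^ k * (1 - t) ^ (-(1 - a + k))) := by
    rw [Finset.mul_sum]
    refine Finset.sum_congr rfl fun k _ => ?_
    rw [risingFac_sub_natCast, show -(1 - a + k) = a - 1 - k by ring,
      Complex.cpow_sub (a - 1) k h1t, Complex.cpow_natCast,
      -- This sign cancels the one from `(a - k)_k = (-1)^k (1 - a)_k`.
      show (t - 1) ^ k = (-1) ^ k * (1 - t) ^ k by rw [← mul_pow]; ring]
    have : (-1 : ℂ) ^ k ≠ 0 := pow_ne_zero k (by norm_num)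
    field_simp
  rw [e]
  refine h.congr_fun fun n => ?_
  rw [prod_risingFac_natCast_eq_sum_DCoeff]
  simp only [Finset.sum_mul, Finset.sum_div]
  exact Finset.sum_congr rfl fun k _ => by ring

/-! ### Cauchy's formula on a rectangle -/

/-- The integral over the boundary of the rectangle with corners `x₁ + i y₁` and `x₂ + i y₂`,
in the positive sense. -/
noncomputable def rectIntegral (F : ℂ → ℂ) (x₁ x₂ y₁ y₂ : ℝ) : ℂ :=
  (∫ x in x₁..x₂, F (x + y₁ * Complex.I)) - (∫ x in x₁..x₂, F (x + y₂ * Complex.I)) +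
    Complex.I * (∫ y in y₁..y₂, F (x₂ + y * Complex.I)) -
    Complex.I * (∫ y in y₁..y₂, F (x₁ + y * Complex.I))

theorem integral_inv_horizontal {p : ℂ} {x₁ x₂ y : ℝ} (hy : y ≠ p.im) :
    (∫ x in x₁..x₂, ((x + y * Complex.I : ℂ) - p)⁻¹) =
      Complex.log (x₂ + y * Complex.I - p) - Complex.log (x₁ + y * Complex.I - p) := by
  have hs (x : ℝ) : (x + y * Complex.I - p : ℂ) ∈ Complex.slitPlane := by
    right
    simpa [sub_eq_zero] using hy
  refine intervalIntegral.integral_eq_sub_of_hasDerivAt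
    (f := fun x : ℝ => Complex.log (x + y * Complex.I - p)) (fun x _ => ?_) ?_
  · have h1 : HasDerivAt (fun x : ℝ => (x + y * Complex.I - p : ℂ)) 1 x :=
      (((hasDerivAt_id x).ofReal_comp).add_const _).sub_const _
    simpa using h1.clog_real (hs x)
  · refine Continuous.intervalIntegrable ?_ _ _
    exact Continuous.inv₀ (by fun_prop) fun x => Complex.slitPlane_ne_zero (hs x)

/-- On the left side of a rectangle around `p`, `s - p` crosses the cut of the principal logarithm.
There `ε = -1` gives the primitive `log (-(s - p))`, with the same derivative. -/
theorem integral_inv_vertical {p ε : ℂ} (hε : ε * ε = 1) {x y₁ y₂ : ℝ}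
    (hs : ∀ y : ℝ, ε * (x + y * Complex.I - p : ℂ) ∈ Complex.slitPlane) :
    Complex.I * (∫ y in y₁..y₂, ((x + y * Complex.I : ℂ) - p)⁻¹) =
      Complex.log (ε * (x + y₂ * Complex.I - p)) - Complex.log (ε * (x + y₁ * Complex.I - p)) := by
  have hε0 : ε ≠ 0 := left_ne_zero_of_mul (hε ▸ one_ne_zero)
  have h0 (y : ℝ) : (x + y * Complex.I - p : ℂ) ≠ 0 :=
    right_ne_zero_of_mul (Complex.slitPlane_ne_zero (hs y))
  rw [← intervalIntegral.integral_const_mul]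
  refine intervalIntegral.integral_eq_sub_of_hasDerivAt
    (f := fun y : ℝ => Complex.log (ε * (x + y * Complex.I - p))) (fun y _ => ?_) ?_
  · have h1 : HasDerivAt (fun y : ℝ => ε * (x + y * Complex.I - p : ℂ)) (ε * (1 * Complex.I)) y :=
      ((((hasDerivAt_id y).ofReal_comp).mul_const _).const_add _ |>.sub_const _).const_mul _
    have h2 := h1.clog_real (hs y)
    rw [one_mul, mul_div_mul_left _ _ hε0, div_eq_mul_inv] at h2
    exact h2
  · refine Continuous.intervalIntegrable ?_ _ _
    exact continuous_const.mul (Continuous.inv₀ (by fun_prop) h0)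

theorem Complex.log_neg_of_im_pos {z : ℂ} (hz : 0 < z.im) :
    Complex.log (-z) = Complex.log z - Real.pi * Complex.I := by
  rw [Complex.log, Complex.log, norm_neg, Complex.arg_neg_eq_arg_sub_pi_of_im_pos hz]
  push_cast
  ring

theorem Complex.log_neg_of_im_neg {z : ℂ} (hz : z.im < 0) :
    Complex.log (-z) = Complex.log z + Real.pi * Complex.I := by
  rw [Complex.log, Complex.log, norm_neg, Complex.arg_neg_eq_arg_add_pi_of_im_neg hz]
  push_cast
  ring

theorem rectIntegral_inv {p : ℂ} {x₁ x₂ y₁ y₂ : ℝ} (hx₁ : x₁ < p.re) (hx₂ : p.re < x₂)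
    (hy₁ : y₁ < p.im) (hy₂ : p.im < y₂) :
    rectIntegral (fun s => (s - p)⁻¹) x₁ x₂ y₁ y₂ = 2 * Real.pi * Complex.I := by
  rw [rectIntegral, integral_inv_horizontal hy₁.ne, integral_inv_horizontal hy₂.ne',
    integral_inv_vertical (ε := 1) (by norm_num) (fun y => by left; simpa using hx₂),
    integral_inv_vertical (ε := -1) (by norm_num) (fun y => by left; simpa using hx₁)]
  simp only [one_mul, neg_one_mul]
  -- The logarithms cancel at all corners except for the change of branch on the left side, which
  -- adds `πi` at each of its two ends.
  rw [Complex.log_neg_of_im_pos (by simpa using hy₂), Complex.log_neg_of_im_neg (by simpa using hy₁)]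
  ring

theorem rectIntegral_congr {F G : ℂ → ℂ} {x₁ x₂ y₁ y₂ : ℝ}
    (h : ∀ s ∈ Set.uIcc x₁ x₂ ×ℂ Set.uIcc y₁ y₂,
      (s.re = x₁ ∨ s.re = x₂ ∨ s.im = y₁ ∨ s.im = y₂) → F s = G s) :
    rectIntegral F x₁ x₂ y₁ y₂ = rectIntegral G x₁ x₂ y₁ y₂ := by
  have hh (y : ℝ) (hy : y = y₁ ∨ y = y₂) :
      (∫ x in x₁..x₂, F (x + y * Complex.I)) = ∫ x in x₁..x₂, G (x + y * Complex.I) := by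
    refine intervalIntegral.integral_congr fun x hx => h _ ?_ ?_
    · rcases hy with rfl | rfl <;> simpa [Complex.mem_reProdIm] using hx
    · simp only [Complex.add_re, Complex.add_im]
      rcases hy with rfl | rfl <;> simp
  have hv (x : ℝ) (hx : x = x₁ ∨ x = x₂) :
      (∫ y in y₁..y₂, F (x + y * Complex.I)) = ∫ y in y₁..y₂, G (x + y * Complex.I) := by
    refine intervalIntegral.integral_congr fun y hy => h _ ?_ ?_
    · rcases hx with rfl | rfl <;> simpa [Complex.mem_reProdIm] using hy
    · rcases hx with rfl | rfl <;> simp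
  rw [rectIntegral, rectIntegral, hh _ (.inl rfl), hh _ (.inr rfl), hv _ (.inl rfl), hv _ (.inr rfl)]

theorem continuousOn_horizontal {F : ℂ → ℂ} {S : Set ℂ} (hF : ContinuousOn F S) {T : Set ℝ}
    {y : ℝ} (h : ∀ x ∈ T, (x + y * Complex.I : ℂ) ∈ S) :
    ContinuousOn (fun x : ℝ => F (x + y * Complex.I)) T :=
  hF.comp (Continuous.continuousOn (by fun_prop)) h

theorem continuousOn_vertical {F : ℂ → ℂ} {S : Set ℂ} (hF : ContinuousOn F S) {T : Set ℝ}
    {x : ℝ} (h : ∀ y ∈ T, (x + y * Complex.I : ℂ) ∈ S) :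
    ContinuousOn (fun y : ℝ => F (x + y * Complex.I)) T :=
  hF.comp (Continuous.continuousOn (by fun_prop)) h

theorem rectIntegral_add {F G : ℂ → ℂ} {x₁ x₂ y₁ y₂ : ℝ} {S : Set ℂ}
    (hF : ContinuousOn F S) (hG : ContinuousOn G S)
    (hS : ∀ s ∈ Set.uIcc x₁ x₂ ×ℂ Set.uIcc y₁ y₂,
      (s.re = x₁ ∨ s.re = x₂ ∨ s.im = y₁ ∨ s.im = y₂) → s ∈ S) :
    rectIntegral (fun s => F s + G s) x₁ x₂ y₁ y₂ =
      rectIntegral F x₁ x₂ y₁ y₂ + rectIntegral G x₁ x₂ y₁ y₂ := by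
  have hh (y : ℝ) (hy : y = y₁ ∨ y = y₂) :
      (∫ x in x₁..x₂, (F (x + y * Complex.I) + G (x + y * Complex.I))) =
        (∫ x in x₁..x₂, F (x + y * Complex.I)) + ∫ x in x₁..x₂, G (x + y * Complex.I) := by
    have hm : ∀ x ∈ Set.uIcc x₁ x₂, (x + y * Complex.I : ℂ) ∈ S := fun x hx => by
      refine hS _ ?_ ?_
      · rcases hy with rfl | rfl <;> simpa [Complex.mem_reProdIm] using hx
      · rcases hy with rfl | rfl <;> simp
    exact intervalIntegral.integral_add (continuousOn_horizontal hF hm).intervalIntegrable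
      (continuousOn_horizontal hG hm).intervalIntegrable
  have hv (x : ℝ) (hx : x = x₁ ∨ x = x₂) :
      (∫ y in y₁..y₂, (F (x + y * Complex.I) + G (x + y * Complex.I))) =
        (∫ y in y₁..y₂, F (x + y * Complex.I)) + ∫ y in y₁..y₂, G (x + y * Complex.I) := by
    have hm : ∀ y ∈ Set.uIcc y₁ y₂, (x + y * Complex.I : ℂ) ∈ S := fun y hy => by
      refine hS _ ?_ ?_
      · rcases hx with rfl | rfl <;> simpa [Complex.mem_reProdIm] using hy
      · rcases hx with rfl | rfl <;> simp
    exact intervalIntegral.integral_add (continuousOn_vertical hF hm).intervalIntegrable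
      (continuousOn_vertical hG hm).intervalIntegrable
  simp only [rectIntegral]
  rw [hh _ (.inl rfl), hh _ (.inr rfl), hv _ (.inl rfl), hv _ (.inr rfl)]
  ring

theorem rectIntegral_const_mul (a : ℂ) (F : ℂ → ℂ) (x₁ x₂ y₁ y₂ : ℝ) :
    rectIntegral (fun s => a * F s) x₁ x₂ y₁ y₂ = a * rectIntegral F x₁ x₂ y₁ y₂ := by
  simp only [rectIntegral, intervalIntegral.integral_const_mul]
  ring

/-- Cauchy's integral formula for a rectangle. -/
theorem rectIntegral_div_sub {g : ℂ → ℂ} {p : ℂ} {x₁ x₂ y₁ y₂ : ℝ} {U : Set ℂ} (hU : IsOpen U)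
    (hg : DifferentiableOn ℂ g U) (hUr : Set.Icc x₁ x₂ ×ℂ Set.Icc y₁ y₂ ⊆ U)
    (hx₁ : x₁ < p.re) (hx₂ : p.re < x₂) (hy₁ : y₁ < p.im) (hy₂ : p.im < y₂) :
    rectIntegral (fun s => g s / (s - p)) x₁ x₂ y₁ y₂ = 2 * Real.pi * Complex.I * g p := by
  have hx : x₁ ≤ x₂ := (hx₁.trans hx₂).le
  have hy : y₁ ≤ y₂ := (hy₁.trans hy₂).le
  rw [← Set.uIcc_of_le hx, ← Set.uIcc_of_le hy] at hUr
  have hpU : p ∈ U := hUr (by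
    rw [Set.uIcc_of_le hx, Set.uIcc_of_le hy, Complex.mem_reProdIm]
    exact ⟨⟨hx₁.le, hx₂.le⟩, hy₁.le, hy₂.le⟩)
  have hd : DifferentiableOn ℂ (dslope g p) U :=
    (Complex.differentiableOn_dslope (hU.mem_nhds hpU)).2 hg
  have h0 : rectIntegral (dslope g p) x₁ x₂ y₁ y₂ = 0 := by
    have := Complex.integral_boundary_rect_eq_zero_of_differentiableOn (dslope g p)
      ⟨x₁, y₁⟩ ⟨x₂, y₂⟩ (hd.mono hUr)
    simpa [rectIntegral] using this
  have hne (s : ℂ) (h : s.re = x₁ ∨ s.re = x₂ ∨ s.im = y₁ ∨ s.im = y₂) : s ≠ p := by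
    rintro rfl
    rcases h with h | h | h | h <;> linarith
  rw [rectIntegral_congr (G := fun s => dslope g p s + g p * (s - p)⁻¹)]
  · rw [rectIntegral_add (S := U \ {p}) (hd.continuousOn.mono Set.sdiff_subset),
      rectIntegral_const_mul, h0, rectIntegral_inv hx₁ hx₂ hy₁ hy₂]
    · ring
    · refine continuousOn_const.mul (ContinuousOn.inv₀ (by fun_prop) fun s hs => ?_)
      exact sub_ne_zero.2 hs.2
    · exact fun s hs h => ⟨hUr hs, hne s h⟩
  · intro s _ h
    have : s - p ≠ 0 := sub_ne_zero.2 (hne s h)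
    rw [dslope_of_ne _ (hne s h), slope_def_field]
    field_simp
    ring

theorem rectIntegral_add_adjacent {F : ℂ → ℂ} {x₁ x₂ x₃ y₁ y₂ : ℝ}
    (h₁ : ∀ a b : ℝ, IntervalIntegrable (fun x : ℝ => F (x + y₁ * Complex.I)) MeasureTheory.volume a b)
    (h₂ : ∀ a b : ℝ, IntervalIntegrable (fun x : ℝ => F (x + y₂ * Complex.I)) MeasureTheory.volume a b) :
    rectIntegral F x₁ x₂ y₁ y₂ + rectIntegral F x₂ x₃ y₁ y₂ = rectIntegral F x₁ x₃ y₁ y₂ := by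
  simp only [rectIntegral]
  rw [← intervalIntegral.integral_add_adjacent_intervals (h₁ x₁ x₂) (h₁ x₂ x₃),
    ← intervalIntegral.integral_add_adjacent_intervals (h₂ x₁ x₂) (h₂ x₂ x₃)]
  ring

/-! ### The reduced integrand -/

theorem inv_Gamma_eq_risingFac_mul (z : ℂ) (n : ℕ) :
    (Complex.Gamma z)⁻¹ = risingFac z n * (Complex.Gamma (z + n))⁻¹ := by
  induction n with
  | zero => simp [risingFac_zero]
  | succ n ih =>
    rw [ih, Complex.one_div_Gamma_eq_self_mul_one_div_Gamma_add_one (z + n), risingFac_succ]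
    push_cast
    ring_nf

/-- `Γ(b - s) / Γ(c - s) * ∏ᵢ (fᵢ - s)_{mᵢ} * t ^ s`: the integrand of the Meijer–Nørlund function
`G(t | c, f; b, f + m)` after cancellation of the gamma functions. -/
noncomputable def reducedIntegrand {r : ℕ} (m : Fin r → ℕ) (f : Fin r → ℂ) (b c t s : ℂ) : ℂ :=
  Complex.Gamma (b - s) * (Complex.Gamma (c - s))⁻¹ * (∏ i, risingFac (f i - s) (m i)) * t ^ s

section

variable {r : ℕ} {m : Fin r → ℕ} {f : Fin r → ℂ} {b c t : ℂ}

/-- The hypothesis excludes the poles of `Γ(fᵢ + mᵢ - s)`, where `Complex.Gamma` has the value `0`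
and the cancellation can fail. -/
theorem meijerIntegrand_eq_reducedIntegrand {s : ℂ} (h : ∀ i, ∀ k : ℕ, f i + m i - s ≠ -k) :
    meijerIntegrand (Matrix.vecCons c f) (Matrix.vecCons b (fun i => f i + (m i : ℂ))) t s =
      reducedIntegrand m f b c t s := by
  have key : (∏ i, Complex.Gamma (f i + m i - s)) * ∏ i, (Complex.Gamma (f i - s))⁻¹ =
      ∏ i, risingFac (f i - s) (m i) := by
    rw [← Finset.prod_mul_distrib]
    refine Finset.prod_congr rfl fun i _ => ?_
    have h0 := Complex.Gamma_ne_zero (h i)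
    rw [inv_Gamma_eq_risingFac_mul (f i - s) (m i), show f i - s + m i = f i + m i - s by ring]
    field_simp
  rw [meijerIntegrand, reducedIntegrand, Fin.prod_univ_succ, Fin.prod_univ_succ, ← key]
  simp only [Matrix.cons_val_zero, Matrix.cons_val_succ]
  ring

theorem differentiableAt_reducedIntegrand (ht : t ≠ 0) {s : ℂ} (hs : ∀ k : ℕ, b - s ≠ -k) :
    DifferentiableAt ℂ (reducedIntegrand m f b c t) s := by
  have h1 : DifferentiableAt ℂ (fun s => Complex.Gamma (b - s)) s :=
    (Complex.differentiableAt_Gamma _ hs).comp s (f := fun s => b - s) (by fun_prop)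
  have h2 : DifferentiableAt ℂ (fun s => (Complex.Gamma (c - s))⁻¹) s :=
    (Complex.differentiable_one_div_Gamma _).comp s (f := fun s => c - s) (by fun_prop)
  have h3 : DifferentiableAt ℂ (fun s => ∏ i, risingFac (f i - s) (m i)) s :=
    DifferentiableAt.fun_finsetProd fun i _ =>
      (differentiable_risingFac (m i) _).comp s (f := fun s => f i - s) (by fun_prop)
  exact ((h1.mul h2).mul h3).mul (differentiableAt_id.const_cpow (.inl ht))

theorem continuousOn_reducedIntegrand (ht : t ≠ 0) :
    ContinuousOn (reducedIntegrand m f b c t) {s | ∀ k : ℕ, b - s ≠ -k} := fun _ hs =>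
  (differentiableAt_reducedIntegrand ht hs).continuousAt.continuousWithinAt

/-! ### Residues -/

/-- The function `s ↦ (s - (b + n)) * reducedIntegrand m f b c t s`, extended over its removable
singularity at `b + n`. -/
noncomputable def reducedNumerator (m : Fin r → ℕ) (f : Fin r → ℂ) (b c t : ℂ) (n : ℕ) (s : ℂ) :
    ℂ :=
  -(Complex.Gamma (b - s + (n + 1 : ℕ)) * (risingFac (b - s) n)⁻¹) * (Complex.Gamma (c - s))⁻¹ *
    (∏ i, risingFac (f i - s) (m i)) * t ^ s

/-- `Γ(z) = Γ(z + n + 1) / (z)_{n+1}` with `z = b - s`; the last factor `z + n` of the denominator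
is `-(s - (b + n))`. -/
theorem reducedIntegrand_eq_div {s : ℂ} (hs : ∀ k : ℕ, b - s ≠ -k) (n : ℕ) :
    reducedIntegrand m f b c t s = reducedNumerator m f b c t n s / (s - (b + n)) := by
  have h0 := Complex.Gamma_ne_zero hs
  have h1 := inv_Gamma_eq_risingFac_mul (b - s) (n + 1)
  have h2 : risingFac (b - s) (n + 1) ≠ 0 := by
    intro h
    rw [h, zero_mul] at h1
    exact inv_ne_zero h0 h1
  have h3 : Complex.Gamma (b - s) =
      Complex.Gamma (b - s + (n + 1 : ℕ)) * (risingFac (b - s) (n + 1))⁻¹ := by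
    rw [← inv_inj, h1, mul_inv, inv_inv, mul_comm]
  rw [reducedIntegrand, reducedNumerator, h3, risingFac_succ, mul_inv,
    show b - s + n = -(s - (b + n)) by ring, inv_neg]
  ring

/-- The bound on `s.re` keeps `Γ(b - s + n + 1)` regular; the second condition removes the earlier
poles `b, …, b + n - 1`. -/
theorem isOpen_reducedNumerator_domain (b : ℂ) (n : ℕ) :
    IsOpen {s : ℂ | s.re < b.re + (n + 1) ∧ risingFac (b - s) n ≠ 0} := by
  refine (isOpen_lt Complex.continuous_re continuous_const).inter (isOpen_ne_fun ?_ continuous_const)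
  exact (differentiable_risingFac n).continuous.comp (by fun_prop)

theorem differentiableOn_reducedNumerator (ht : t ≠ 0) (n : ℕ) :
    DifferentiableOn ℂ (reducedNumerator m f b c t n)
      {s : ℂ | s.re < b.re + (n + 1) ∧ risingFac (b - s) n ≠ 0} := by
  rintro s ⟨hs, hs'⟩
  refine DifferentiableAt.differentiableWithinAt ?_
  have h1 : DifferentiableAt ℂ (fun s => Complex.Gamma (b - s + (n + 1 : ℕ))) s := by
    refine (Complex.differentiableAt_Gamma _ fun k hk => ?_).comp s
      (f := fun s => b - s + (n + 1 : ℕ)) (by fun_prop)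
    have := congrArg Complex.re hk
    simp at this
    have hk0 : (0 : ℝ) ≤ k := k.cast_nonneg
    linarith
  have h1' : DifferentiableAt ℂ (fun s => (risingFac (b - s) n)⁻¹) s :=
    DifferentiableAt.fun_inv
      ((differentiable_risingFac n _).comp s (f := fun s => b - s) (by fun_prop)) hs'
  have h2 : DifferentiableAt ℂ (fun s => (Complex.Gamma (c - s))⁻¹) s :=
    (Complex.differentiable_one_div_Gamma _).comp s (f := fun s => c - s) (by fun_prop)
  have h3 : DifferentiableAt ℂ (fun s => ∏ i, risingFac (f i - s) (m i)) s :=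
    DifferentiableAt.fun_finsetProd fun i _ =>
      (differentiable_risingFac (m i) _).comp s (f := fun s => f i - s) (by fun_prop)
  exact (((h1.mul h1').neg.mul h2).mul h3).mul (differentiableAt_id.const_cpow (.inl ht))

theorem reducedNumerator_self (ht : t ≠ 0) (n : ℕ) :
    reducedNumerator m f b c t n (b + n) = -(t ^ b / Complex.Gamma (c - b) *
      ((∏ i, risingFac (f i - b - n) (m i)) * risingFac (1 - (c - b)) n * t ^ n /
        (n.factorial : ℂ))) := by
  have hn : (n.factorial : ℂ) ≠ 0 := by exact_mod_cast n.factorial_ne_zero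
  have h1 : (-1 : ℂ) ^ n ≠ 0 := pow_ne_zero n (by norm_num)
  rw [reducedNumerator, inv_Gamma_eq_risingFac_mul (c - (b + n)) n,
    show c - (b + n) = c - b - n by ring, risingFac_sub_natCast, sub_add_cancel,
    show b - (b + n) = -(n : ℂ) by ring, risingFac_neg_natCast, Nat.descFactorial_self,
    Complex.cpow_add _ _ ht, Complex.cpow_natCast]
  simp only [← sub_sub]
  push_cast
  rw [neg_add_cancel_left, Complex.Gamma_one]
  field_simp

/-- The rectangle contains exactly the pole `b + n`. For `n = 0` there is no pole further left, so
`x₁` may be arbitrarily small. -/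
theorem rectIntegral_reducedIntegrand (ht : t ≠ 0) {x₁ x₂ Y : ℝ} (n : ℕ)
    (hx₁ : x₁ < b.re + n) (hx₁' : n ≠ 0 → b.re + n - 1 < x₁) (hx₂ : b.re + n < x₂)
    (hx₂' : x₂ < b.re + n + 1) (hY : |b.im| < Y) :
    rectIntegral (reducedIntegrand m f b c t) x₁ x₂ (-Y) Y =
      -(2 * Real.pi * Complex.I * (t ^ b / Complex.Gamma (c - b) *
      ((∏ i, risingFac (f i - b - n) (m i)) * risingFac (1 - (c - b)) n * t ^ n /
        (n.factorial : ℂ)))) := by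
  have hY' := abs_lt.1 hY
  have hU : Set.Icc x₁ x₂ ×ℂ Set.Icc (-Y) Y ⊆
      {s : ℂ | s.re < b.re + (n + 1) ∧ risingFac (b - s) n ≠ 0} := by
    intro s hs
    rw [Complex.mem_reProdIm] at hs
    refine ⟨by linarith [hs.1.2], fun h => ?_⟩
    rw [risingFac, ascPochhammer_eval_eq_zero_iff] at h
    obtain ⟨k, hk, hks⟩ := h
    have h2 := congrArg Complex.re hks
    have hk1 : (k : ℝ) + 1 ≤ n := by exact_mod_cast hk
    simp at h2
    linarith [hs.1.1, hx₁' (by omega)]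
  have h := rectIntegral_div_sub (p := b + n) (isOpen_reducedNumerator_domain b n)
    (differentiableOn_reducedNumerator (m := m) (f := f) (c := c) ht n) hU
    (by simpa using hx₁) (by simpa using hx₂) (by simpa using hY'.1) (by simpa using hY'.2)
  rw [reducedNumerator_self ht, mul_neg] at h
  rw [← h]
  refine rectIntegral_congr fun s hs hs' => reducedIntegrand_eq_div (fun k hk => ?_) n
  rw [Set.uIcc_of_le (by linarith), Set.uIcc_of_le (by linarith), Complex.mem_reProdIm] at hs
  have hre := congrArg Complex.re hk
  have him := congrArg Complex.im hk
  simp at hre him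
  have hcase : (k : ℝ) + 1 ≤ n ∨ k = n ∨ (n : ℝ) + 1 ≤ k := by
    rcases lt_trichotomy k n with h | h | h
    · left; exact_mod_cast h
    · right; left; exact h
    · right; right; exact_mod_cast h
  rcases hs' with h | h | h | h
  · rcases hcase with h' | rfl | h'
    · have hn : n ≠ 0 := by
        rintro rfl
        have := k.cast_nonneg (α := ℝ)
        push_cast at h'
        linarith
      linarith [hx₁' hn]
    · linarith
    · linarith
  · rcases hcase with h' | rfl | h' <;> linarith
  · linarith
  · linarith

theorem horizontal_notMem_poles {x y : ℝ} (hy : y ≠ b.im) (k : ℕ) :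
    b - (x + y * Complex.I) ≠ -k := by
  intro h
  have := congrArg Complex.im h
  simp at this
  exact hy (by linarith)

theorem continuous_reducedIntegrand_horizontal (ht : t ≠ 0) {y : ℝ} (hy : y ≠ b.im) :
    Continuous fun x : ℝ => reducedIntegrand m f b c t (x + y * Complex.I) := by
  rw [← continuousOn_univ]
  exact continuousOn_horizontal (continuousOn_reducedIntegrand ht)
    fun x _ => horizontal_notMem_poles hy

/-- The right side passes halfway between the poles `b + N` and `b + N + 1`, so adjacent rectangles
each add one residue. -/
theorem rectIntegral_reducedIntegrand_eq_sum (ht : t ≠ 0) {X Y : ℝ} (hX : X < b.re)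
    (hY : |b.im| < Y) (N : ℕ) :
    rectIntegral (reducedIntegrand m f b c t) X (b.re + N + 1 / 2) (-Y) Y =
      -(2 * Real.pi * Complex.I * (t ^ b / Complex.Gamma (c - b) * ∑ n ∈ Finset.range (N + 1),
      ((∏ i, risingFac (f i - b - n) (m i)) * risingFac (1 - (c - b)) n * t ^ n /
        (n.factorial : ℂ)))) := by
  have hY' := abs_lt.1 hY
  induction N with
  | zero =>
    rw [rectIntegral_reducedIntegrand ht 0 (by simpa using hX) (fun h => absurd rfl h)
      (by norm_num) (by norm_num) hY]
    simp
  | succ N ih =>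
    rw [← rectIntegral_add_adjacent (x₂ := b.re + N + 1 / 2), ih,
      rectIntegral_reducedIntegrand ht (N + 1) (by push_cast; linarith)
        (fun _ => by push_cast; linarith) (by linarith) (by linarith) hY,
      Finset.sum_range_succ _ (N + 1)]
    · ring
    · exact fun _ _ => (continuous_reducedIntegrand_horizontal ht hY'.1.ne).intervalIntegrable _ _
    · exact fun _ _ => (continuous_reducedIntegrand_horizontal ht hY'.2.ne').intervalIntegrable _ _

/-! ### Decay to the right -/

open Filter Topology

/-- The filter `comap Complex.re atTop` makes the limit uniform in `Im s`, as needed on whole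
vertical segments. -/
theorem tendsto_sub_div_sub_re_atTop (a b : ℂ) :
    Tendsto (fun s : ℂ => (a - (s + 1)) / (b - (s + 1))) (comap Complex.re atTop) (𝓝 1) := by
  have hre : Tendsto (fun s : ℂ => s.re + (1 - b.re)) (comap Complex.re atTop) atTop :=
    tendsto_atTop_add_const_right _ _ tendsto_comap
  have hnorm : Tendsto (fun s : ℂ => ‖b - (s + 1)‖) (comap Complex.re atTop) atTop := by
    refine tendsto_atTop_mono (fun s => ?_) hre
    have := Complex.abs_re_le_norm (b - (s + 1))
    refine le_trans ?_ ((neg_le_abs _).trans this)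
    simp
    linarith
  have hinv : Tendsto (fun s : ℂ => (b - (s + 1))⁻¹) (comap Complex.re atTop) (𝓝 0) :=
    tendsto_inv₀_cobounded.comp (tendsto_norm_atTop_iff_cobounded.1 hnorm)
  have h := (hinv.const_mul (a - b)).const_add 1
  rw [mul_zero, add_zero] at h
  refine h.congr' ?_
  filter_upwards [hnorm.eventually_gt_atTop 0] with s hs
  have h0 : b - (s + 1) ≠ 0 := norm_pos_iff.1 hs
  field_simp
  ring

theorem reducedIntegrand_add_one (ht : t ≠ 0) {s : ℂ} (hb : b - (s + 1) ≠ 0)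
    (hf : ∀ i, f i + m i - (s + 1) ≠ 0) :
    reducedIntegrand m f b c t (s + 1) = reducedIntegrand m f b c t s *
      (t * ((c - (s + 1)) / (b - (s + 1))) *
        ∏ i, (f i - (s + 1)) / (f i + m i - (s + 1))) := by
  have h1 : Complex.Gamma (b - s) = (b - (s + 1)) * Complex.Gamma (b - (s + 1)) := by
    rw [← Complex.Gamma_add_one _ hb]
    congr 1
    ring
  have h2 : (Complex.Gamma (c - (s + 1)))⁻¹ = (c - (s + 1)) * (Complex.Gamma (c - s))⁻¹ := by
    rw [Complex.one_div_Gamma_eq_self_mul_one_div_Gamma_add_one]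
    congr 3
    ring
  have h3 : ∏ i, risingFac (f i - (s + 1)) (m i) = (∏ i, risingFac (f i - s) (m i)) *
      ∏ i, (f i - (s + 1)) / (f i + m i - (s + 1)) := by
    rw [← Finset.prod_mul_distrib]
    refine Finset.prod_congr rfl fun i _ => ?_
    have e1 := risingFac_succ (f i - (s + 1)) (m i)
    rw [risingFac_succ', show f i - (s + 1) + 1 = f i - s by ring,
      show f i - (s + 1) + m i = f i + m i - (s + 1) by ring] at e1
    have := hf i
    field_simp
    linear_combination -e1
  rw [reducedIntegrand, reducedIntegrand, h1, h2, h3, Complex.cpow_add _ _ ht, Complex.cpow_one]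
  field_simp

theorem exists_norm_reducedIntegrand_add_one_le (m : Fin r → ℕ) (f : Fin r → ℂ) (b c : ℂ)
    (ht : t ≠ 0) {ρ : ℝ} (hρ : ‖t‖ < ρ) :
    ∃ N : ℝ, ∀ s : ℂ, N ≤ s.re →
      ‖reducedIntegrand m f b c t (s + 1)‖ ≤ ρ * ‖reducedIntegrand m f b c t s‖ := by
  have hlim : Tendsto (fun s : ℂ => t * ((c - (s + 1)) / (b - (s + 1))) *
      ∏ i, (f i - (s + 1)) / (f i + m i - (s + 1))) (comap Complex.re atTop) (𝓝 t) := by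
    simpa using ((tendsto_sub_div_sub_re_atTop c b).const_mul t).mul
      (tendsto_finsetProd Finset.univ fun i _ =>
        tendsto_sub_div_sub_re_atTop (f i) (f i + m i))
  have h0 (a : ℂ) : ∀ᶠ s in comap Complex.re atTop, a - (s + 1) ≠ 0 := by
    filter_upwards [tendsto_comap.eventually_gt_atTop a.re] with s hs h
    have := congrArg Complex.re h
    simp at this
    linarith
  have hev := (hlim.norm.eventually_lt_const hρ).and
    ((h0 b).and (eventually_all.2 fun i => h0 (f i + m i)))
  rw [eventually_comap, eventually_atTop] at hev
  obtain ⟨N, hN⟩ := hev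
  refine ⟨N, fun s hs => ?_⟩
  obtain ⟨h1, h2, h3⟩ := hN s.re hs s rfl
  rw [reducedIntegrand_add_one ht h2 h3, norm_mul, mul_comm]
  exact mul_le_mul_of_nonneg_right h1.le (norm_nonneg _)

theorem integrableOn_Ioi_of_norm_add_one_le {g : ℝ → ℂ} (hg : Continuous g) {ρ N : ℝ}
    (hρ0 : 0 < ρ) (hρ1 : ρ < 1) (h : ∀ x, N ≤ x → ‖g (x + 1)‖ ≤ ρ * ‖g x‖) (X : ℝ) :
    MeasureTheory.IntegrableOn g (Set.Ioi X) := by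
  obtain ⟨M, hM⟩ := (isCompact_Icc (a := N) (b := N + 1)).exists_bound_of_continuousOn
    hg.continuousOn
  have hM0 : 0 ≤ M := (norm_nonneg _).trans (hM N ⟨le_rfl, by linarith⟩)
  have hlog : Real.log ρ < 0 := Real.log_neg hρ0 hρ1
  have hbound (n : ℕ) : ∀ x, N ≤ x → x ≤ N + 1 → ‖g (x + n)‖ ≤ ρ ^ n * M := by
    intro x hx hx'
    induction n with
    | zero => simpa using hM x ⟨hx, hx'⟩
    | succ n ih =>
      have hn : (0 : ℝ) ≤ n := n.cast_nonneg
      have := h (x + n) (by linarith)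
      rw [Nat.cast_succ, ← add_assoc, pow_succ']
      calc _ ≤ ρ * ‖g (x + n)‖ := this
        _ ≤ ρ * (ρ ^ n * M) := by gcongr
        _ = _ := by ring
  -- `x` is reached from `[N, N + 1]` in `⌊x - N⌋₊` steps, more than `x - N - 1`; this is the source
  -- of `N + 1` in the constant.
  have hexp (x : ℝ) (hx : N ≤ x) :
      ‖g x‖ ≤ M * Real.exp (-Real.log ρ * (N + 1)) * ‖Real.exp (-(-Real.log ρ) * x)‖ := by
    have h1 := Nat.floor_le (sub_nonneg.2 hx)
    have h2 := Nat.lt_floor_add_one (x - N)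
    have h3 := hbound ⌊x - N⌋₊ (x - ⌊x - N⌋₊) (by linarith) (by linarith)
    rw [sub_add_cancel] at h3
    refine h3.trans ?_
    rw [Real.norm_of_nonneg (Real.exp_pos _).le, mul_assoc, ← Real.exp_add, mul_comm]
    refine mul_le_mul_of_nonneg_left ?_ hM0
    rw [← Real.rpow_natCast, Real.rpow_def_of_pos hρ0, Real.exp_le_exp]
    nlinarith
  refine (MeasureTheory.integrable_norm_iff hg.aestronglyMeasurable).1 ?_
  refine integrable_of_isBigO_exp_neg (b := -Real.log ρ) (by linarith) hg.norm.continuousOn ?_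
  refine Asymptotics.IsBigO.of_bound (M * Real.exp (-Real.log ρ * (N + 1))) ?_
  filter_upwards [eventually_ge_atTop N] with x hx
  simpa using hexp x hx

theorem integrableOn_reducedIntegrand_horizontal (ht : t ≠ 0) (ht1 : ‖t‖ < 1) {y : ℝ}
    (hy : y ≠ b.im) (X : ℝ) :
    MeasureTheory.IntegrableOn (fun x : ℝ => reducedIntegrand m f b c t (x + y * Complex.I))
      (Set.Ioi X) := by
  obtain ⟨ρ, hρ, hρ1⟩ := exists_between ht1
  obtain ⟨N, hN⟩ := exists_norm_reducedIntegrand_add_one_le m f b c ht hρ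
  refine integrableOn_Ioi_of_norm_add_one_le (continuous_reducedIntegrand_horizontal ht hy)
    ((norm_nonneg t).trans_lt hρ) hρ1 (N := N) (fun x hx => ?_) X
  have := hN (x + y * Complex.I) (by simpa using hx)
  rwa [show (x : ℂ) + y * Complex.I + 1 = (x + 1 : ℝ) + y * Complex.I by push_cast; ring] at this

theorem tendsto_integral_reducedIntegrand_vertical (ht : t ≠ 0) (ht1 : ‖t‖ < 1) (Y : ℝ) :
    Tendsto (fun N : ℕ => ∫ y in (-Y)..Y,
      reducedIntegrand m f b c t ((b.re + N + 1 / 2 : ℝ) + y * Complex.I)) atTop (𝓝 0) := by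
  obtain ⟨ρ, hρ, hρ1⟩ := exists_between ht1
  have hρ0 : 0 ≤ ρ := (norm_nonneg t).trans hρ.le
  obtain ⟨N, hN⟩ := exists_norm_reducedIntegrand_add_one_le m f b c ht hρ
  obtain ⟨n₀, hn₀⟩ := exists_nat_ge (N - b.re)
  have hcont : Continuous fun y : ℝ =>
      reducedIntegrand m f b c t ((b.re + n₀ + 1 / 2 : ℝ) + y * Complex.I) := by
    rw [← continuousOn_univ]
    refine continuousOn_vertical (continuousOn_reducedIntegrand ht) fun y _ k hk => ?_
    have h := congrArg Complex.re hk
    simp at h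
    -- A pole on this half-integer line would violate parity.
    have h2 : (2 * k : ℝ) = 2 * n₀ + 1 := by linarith
    have h3 : 2 * k = 2 * n₀ + 1 := by exact_mod_cast h2
    omega
  obtain ⟨M, hM⟩ := (isCompact_uIcc (a := -Y) (b := Y)).exists_bound_of_continuousOn
    hcont.continuousOn
  have hbound (n : ℕ) : ∀ y ∈ Set.uIcc (-Y) Y,
      ‖reducedIntegrand m f b c t ((b.re + (n + n₀ : ℕ) + 1 / 2 : ℝ) + y * Complex.I)‖ ≤
        ρ ^ n * M := by
    intro y hy
    induction n with
    | zero => simpa using hM y hy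
    | succ n ih =>
      have hn : (0 : ℝ) ≤ n := n.cast_nonneg
      have := hN ((b.re + (n + n₀ : ℕ) + 1 / 2 : ℝ) + y * Complex.I) (by simp; linarith)
      rw [show ((b.re + (n + n₀ : ℕ) + 1 / 2 : ℝ) + y * Complex.I + 1 : ℂ) =
        (b.re + (n + 1 + n₀ : ℕ) + 1 / 2 : ℝ) + y * Complex.I by push_cast; ring] at this
      calc _ ≤ _ := this
        _ ≤ ρ * (ρ ^ n * M) := by gcongr
        _ = _ := by ring
  rw [← tendsto_add_atTop_iff_nat n₀]
  have hlim : Tendsto (fun n : ℕ => ρ ^ n * M * |Y - -Y|) atTop (𝓝 0) := by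
    simpa using ((tendsto_pow_atTop_nhds_zero_of_lt_one hρ0 hρ1).mul_const M).mul_const |Y - -Y|
  refine squeeze_zero_norm (fun n => ?_) hlim
  exact intervalIntegral.norm_integral_le_of_norm_le_const fun y hy =>
    hbound n y (Set.uIoc_subset_uIcc hy)

/-! ### The loop integral -/

theorem loopIntegrable_reducedIntegrand (ht : t ≠ 0) (ht1 : ‖t‖ < 1) {X Y : ℝ} (hX : X < b.re)
    (hY : |b.im| < Y) : LoopIntegrable (reducedIntegrand m f b c t) X Y := by
  have hY' := abs_lt.1 hY
  refine ⟨?_, ?_, integrableOn_reducedIntegrand_horizontal ht ht1 hY'.2.ne' X⟩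
  · simpa [sub_eq_add_neg] using
      integrableOn_reducedIntegrand_horizontal (m := m) (f := f) (c := c) ht ht1 hY'.1.ne X
  · refine ContinuousOn.intervalIntegrable
      (continuousOn_vertical (continuousOn_reducedIntegrand ht) fun y _ k hk => ?_)
    have h := congrArg Complex.re hk
    simp at h
    linarith [k.cast_nonneg (α := ℝ)]

/-- The loop integral is minus the limit of the rectangle integrals, because the right side tends to
zero. -/
theorem loopIntegral_reducedIntegrand (ht : t ≠ 0) (ht1 : ‖t‖ < 1) {X Y : ℝ} (hX : X < b.re)
    (hY : |b.im| < Y) :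
    loopIntegral (reducedIntegrand m f b c t) X Y =
      2 * Real.pi * Complex.I * (t ^ b / Complex.Gamma (c - b) *
        ((1 - t) ^ (c - b - 1) * ∑ k ∈ Finset.range ((∑ i, m i) + 1),
            DCoeff f m b k * risingFac (c - b - k) k * (t ^ k / (t - 1) ^ k))) := by
  have hY' := abs_lt.1 hY
  have hXN : Tendsto (fun N : ℕ => b.re + N + 1 / 2) atTop atTop :=
    tendsto_atTop_add_const_right _ _
      (tendsto_atTop_add_const_left _ _ tendsto_natCast_atTop_atTop)
  have h1 := MeasureTheory.intervalIntegral_tendsto_integral_Ioi X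
    (integrableOn_reducedIntegrand_horizontal (m := m) (f := f) (c := c) ht ht1 hY'.1.ne X) hXN
  have h2 := MeasureTheory.intervalIntegral_tendsto_integral_Ioi X
    (integrableOn_reducedIntegrand_horizontal (m := m) (f := f) (c := c) ht ht1 hY'.2.ne' X) hXN
  have h3 := tendsto_integral_reducedIntegrand_vertical (m := m) (f := f) (b := b) (c := c)
    ht ht1 Y
  have hlim := (((h1.sub h2).add (h3.const_mul Complex.I)).sub_const
    (Complex.I * ∫ y in (-Y)..Y, reducedIntegrand m f b c t (X + y * Complex.I))).neg
  have hsum := (((hasSum_prod_risingFac_mul_risingFac m f b (c - b) ht1).tendsto_sum_nat.comp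
    -- The `N`-th rectangle contains the `N + 1` poles `b, …, b + N`.
    (tendsto_add_atTop_nat 1)).const_mul
      (t ^ b / Complex.Gamma (c - b))).const_mul (2 * Real.pi * Complex.I)
  have huniq := tendsto_nhds_unique (hlim.congr fun N => ?_) hsum
  · rw [← huniq, loopIntegral]
    simp only [Complex.ofReal_neg, neg_mul, ← sub_eq_add_neg]
    ring
  · have := rectIntegral_reducedIntegrand_eq_sum (m := m) (f := f) (c := c) ht hX hY N
    rw [rectIntegral] at this
    rw [this, neg_neg]
    rfl

/-- The poles `fᵢ + mᵢ + k` satisfy `Re > X` and `|Im| < Y`, so the loop misses them. Agreement on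
the loop is all that the integrals require. -/
theorem IsMeijerLoop.meijerIntegrand_eq {X Y : ℝ}
    (h : IsMeijerLoop (Matrix.vecCons b (fun i => f i + (m i : ℂ))) X Y) {s : ℂ}
    (hs : s.re = X ∨ |s.im| = Y) :
    meijerIntegrand (Matrix.vecCons c f) (Matrix.vecCons b (fun i => f i + (m i : ℂ))) t s =
      reducedIntegrand m f b c t s := by
  refine meijerIntegrand_eq_reducedIntegrand fun i k hk => ?_
  have hi := h.2 i.succ
  rw [Matrix.cons_val_succ] at hi
  have hs' : f i + m i = s - k := by linear_combination hk
  rw [hs'] at hi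
  simp only [Complex.sub_re, Complex.natCast_re, Complex.sub_im, Complex.natCast_im, sub_zero] at hi
  have hk0 : (0 : ℝ) ≤ k := k.cast_nonneg
  rcases hs with hs | hs <;> linarith

theorem IsMeijerLoop.bounds {X Y : ℝ}
    (h : IsMeijerLoop (Matrix.vecCons b (fun i => f i + (m i : ℂ))) X Y) :
    X < b.re ∧ |b.im| < Y := by
  simpa using h.2 0

theorem IsMeijerLoop.loopIntegrable_meijerIntegrand (ht : t ≠ 0) (ht1 : ‖t‖ < 1) {X Y : ℝ}
    (h : IsMeijerLoop (Matrix.vecCons b (fun i => f i + (m i : ℂ))) X Y) :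
    LoopIntegrable (meijerIntegrand (Matrix.vecCons c f)
      (Matrix.vecCons b (fun i => f i + (m i : ℂ))) t) X Y := by
  have hint := loopIntegrable_reducedIntegrand (m := m) (f := f) (c := c) ht ht1 h.bounds.1 h.bounds.2
  have hY : |Y| = Y := abs_of_pos h.1
  have h1 (x : ℝ) := h.meijerIntegrand_eq (c := c) (t := t) (s := x - Y * Complex.I)
    (by simp [hY])
  have h2 (y : ℝ) := h.meijerIntegrand_eq (c := c) (t := t) (s := X + y * Complex.I) (by simp)
  have h3 (x : ℝ) := h.meijerIntegrand_eq (c := c) (t := t) (s := x + Y * Complex.I)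
    (by simp [hY])
  simpa only [LoopIntegrable, h1, h2, h3] using hint

theorem IsMeijerLoop.meijerLoopValue_eq (ht : t ≠ 0) (ht1 : ‖t‖ < 1) {X Y : ℝ}
    (h : IsMeijerLoop (Matrix.vecCons b (fun i => f i + (m i : ℂ))) X Y) :
    meijerLoopValue (Matrix.vecCons c f) (Matrix.vecCons b (fun i => f i + (m i : ℂ))) t X Y =
      t ^ b * (1 - t) ^ (c - b - 1) / Complex.Gamma (c - b) *
        ∑ k ∈ Finset.range ((∑ i, m i) + 1),
          DCoeff f m b k * risingFac (c - b - k) k * (t ^ k / (t - 1) ^ k) := by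
  have hY : |Y| = Y := abs_of_pos h.1
  have e : loopIntegral (meijerIntegrand (Matrix.vecCons c f)
      (Matrix.vecCons b (fun i => f i + (m i : ℂ))) t) X Y =
      loopIntegral (reducedIntegrand m f b c t) X Y := by
    have h1 (x : ℝ) := h.meijerIntegrand_eq (c := c) (t := t) (s := x - Y * Complex.I)
      (by simp [hY])
    have h2 (y : ℝ) := h.meijerIntegrand_eq (c := c) (t := t) (s := X + y * Complex.I) (by simp)
    have h3 (x : ℝ) := h.meijerIntegrand_eq (c := c) (t := t) (s := x + Y * Complex.I)
      (by simp [hY])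
    simp only [loopIntegral, h1, h2, h3]
  rw [meijerLoopValue, e, loopIntegral_reducedIntegrand ht ht1 h.bounds.1 h.bounds.2,
    inv_mul_cancel_left₀ Complex.two_pi_I_ne_zero]
  ring

end

theorem mainTheorem9 (r : ℕ) (m : Fin r → ℕ) (hm : ∀ i, 0 < m i) (f : Fin r → ℂ) (b c : ℂ) :
    -- the generating function of the numbers `α_j`
    (∀ x : ℂ, ∏ i, risingFac (f i - b - x) (m i)
        = ∑ j ∈ Finset.range ((∑ i, m i) + 1), alphaCoeff f m b j * x ^ j) ∧
    -- the Mellin–Barnes integral converges and does not depend on the loop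
    (∀ t : ℂ, 0 < ‖t‖ → ‖t‖ < 1 → ∀ X Y : ℝ,
      IsMeijerLoop (Matrix.vecCons b (fun i => f i + (m i : ℂ))) X Y →
        LoopIntegrable (meijerIntegrand (Matrix.vecCons c f)
          (Matrix.vecCons b (fun i => f i + (m i : ℂ))) t) X Y ∧
        meijerLoopValue (Matrix.vecCons c f)
          (Matrix.vecCons b (fun i => f i + (m i : ℂ))) t X Y
          = meijerNorlundG (Matrix.vecCons c f)
              (Matrix.vecCons b (fun i => f i + (m i : ℂ))) t) ∧
    -- the finite sum
    (∀ t : ℂ, 0 < ‖t‖ → ‖t‖ < 1 →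
      meijerNorlundG (Matrix.vecCons c f) (Matrix.vecCons b (fun i => f i + (m i : ℂ))) t
        = t ^ b * (1 - t) ^ (c - b - 1) / Complex.Gamma (c - b) *
          ∑ k ∈ Finset.range ((∑ i, m i) + 1),
            DCoeff f m b k * risingFac (c - b - k) k * (t ^ k / (t - 1) ^ k)) ∧
    -- the hypergeometric form of `D_k`, whenever no denominator in it vanishes
    (∀ k : ℕ, k ≤ ∑ i, m i → (∀ i, risingFac (1 - f i + b - (m i : ℂ)) k ≠ 0) →
      DCoeff f m b k
        = (-1) ^ k * (∏ i, risingFac (f i - b) (m i)) / (k.factorial : ℂ) *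
          hypergeometricPFQ (Matrix.vecCons (-(k : ℂ)) (fun i => 1 - f i + b))
            (fun i => 1 - f i + b - (m i : ℂ)) 1) := by
  -- The closed form for the default loop; any other loop has the same value because it has the same
  -- closed form.
  have hdef {t : ℂ} (h0 : 0 < ‖t‖) (h1 : ‖t‖ < 1) :=
    (isMeijerLoop_default (Matrix.vecCons b (fun i => f i + (m i : ℂ)))).meijerLoopValue_eq
      (c := c) (norm_pos_iff.1 h0) h1
  refine ⟨prod_risingFac_eq_sum_alphaCoeff m f b, fun t h0 h1 X Y h => ⟨?_, ?_⟩,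
    fun t h0 h1 => hdef h0 h1, fun k hk h => DCoeff_eq_hypergeometric m f b hk h⟩
  · exact h.loopIntegrable_meijerIntegrand (norm_pos_iff.1 h0) h1
  · exact (h.meijerLoopValue_eq (norm_pos_iff.1 h0) h1).trans (hdef h0 h1).symm
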